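/- Let $n\ge 0$ and let $S_n$ be the symmetric group on $\{1,\dots,n\}$. The Fomin–Kirillov algebra $FK_n$ is the associative unital $\mathbb{C}$-algebra with generators $x_{ij}$ ($1\le i\ne j\le n$) and relations, for distinct $i,j,k,l$: $$x_{ji}=-x_{ij},\qquad x_{ij}^2=0,\qquad x_{ij}x_{kl}=x_{kl}x_{ij},\qquad x_{ij}x_{jk}+x_{jk}x_{ki}+x_{ki}x_{ij}=0.$$ Let $FK_n^+\subset FK_n$ be the set of linear combinations, with nonnegative real coefficients, of monomials in the generators $x_{ij}$ with $i<j$. The group $S_n$ acts on $FK_n$ by $u(x_{ij})=x_{u(i)u(j)}$; form the corresponding semidirect product $FK_n\rtimes S_n$, in which $x_{ij}\,u=u\,x_{u^{-1}(i)u^{-1}(j)}$ for $u\in S_n$. Let $s_i$ be the transposition of $i$ and $i+1$. Given $v,w\in S_n$ and a reduced expression $w=s_{i_1}\cdots s_{i_\ell}$, put $$x_{w/v}=v^{-1}\sum_J \varphi_J,\qquad \varphi_J=\varphi_1(J)\cdots\varphi_\ell(J),\qquad \varphi_k(J)=\begin{cases}s_{i_k},&k\in J,\\ x_{i_k,i_k+1},&k\notin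 J,\end{cases}$$ where $J$ ranges over the subsets of $\{1,\dots,\ell\}$ for which $\prod_{k\in J}s_{i_k}$ (factors in increasing order of $k$) is a reduced expression for $v$. Collecting the transpositions on the left shows that $x_{w/v}$ is an element of $FK_n$. **Theorem.** For all $v,w\in S_n$, the element $x_{w/v}$ does not depend on the chosen reduced expression of $w$, and $x_{w/v}\in FK_n^+$. -/

import Mathlib

open scoped NNReal

namespace FominKirillov

/-- The defining relations of the Fomin-Kirillov algebra. There is a formal generator for every
ordered pair `(i, j)`; `diag` kills the superfluous ones with `i = j`, and `skew` identifies the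
generator of `(j, i)` with the negative of that of `(i, j)`. -/
inductive Rel (n : ℕ) :
    FreeAlgebra ℂ (Fin n × Fin n) → FreeAlgebra ℂ (Fin n × Fin n) → Prop
  | diag (i : Fin n) : Rel n (FreeAlgebra.ι ℂ (i, i)) 0
  | skew (i j : Fin n) (hij : i ≠ j) :
      Rel n (FreeAlgebra.ι ℂ (i, j)) (-FreeAlgebra.ι ℂ (j, i))
  | sq (i j : Fin n) (hij : i ≠ j) :
      Rel n (FreeAlgebra.ι ℂ (i, j) * FreeAlgebra.ι ℂ (i, j)) 0
  | comm (i j k l : Fin n) (hij : i ≠ j) (hik : i ≠ k) (hil : i ≠ l)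
      (hjk : j ≠ k) (hjl : j ≠ l) (hkl : k ≠ l) :
      Rel n (FreeAlgebra.ι ℂ (i, j) * FreeAlgebra.ι ℂ (k, l))
        (FreeAlgebra.ι ℂ (k, l) * FreeAlgebra.ι ℂ (i, j))
  | cyclic (i j k : Fin n) (hij : i ≠ j) (hjk : j ≠ k) (hik : i ≠ k) :
      Rel n (FreeAlgebra.ι ℂ (i, j) * FreeAlgebra.ι ℂ (j, k)
        + FreeAlgebra.ι ℂ (j, k) * FreeAlgebra.ι ℂ (k, i)
        + FreeAlgebra.ι ℂ (k, i) * FreeAlgebra.ι ℂ (i, j)) 0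

/-- The Fomin-Kirillov algebra `FK_n` over `ℂ`. -/
abbrev FK (n : ℕ) : Type := RingQuot (Rel n)

/-- The generator `x_ij` of `FK_n`; thus `x_ji = -x_ij`, and `x_ii = 0` by convention. -/
noncomputable def x {n : ℕ} (i j : Fin n) : FK n :=
  RingQuot.mkAlgHom ℂ (Rel n) (FreeAlgebra.ι ℂ (i, j))

/-- `FK_n^+`: the set of linear combinations with nonnegative real coefficients of monomials in
the generators `x_ij` with `i < j`. -/
noncomputable def FKPos (n : ℕ) : Submodule ℝ≥0 (FK n) :=
  Submodule.span ℝ≥0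
    {m | ∃ l : List (Fin n × Fin n), (∀ p ∈ l, p.1 < p.2) ∧ m = (l.map fun p => x p.1 p.2).prod}

/-- The index `i` of the simple transposition `s_i = (i, i+1)` (counting from `0`). -/
def lo {n : ℕ} (i : Fin (n - 1)) : Fin n := ⟨i, by omega⟩

/-- The index `i + 1` of the simple transposition `s_i = (i, i+1)` (counting from `0`). -/
def hi {n : ℕ} (i : Fin (n - 1)) : Fin n := ⟨i + 1, by omega⟩

/-- The simple transposition `s_i = (i, i+1)`. -/
def s {n : ℕ} (i : Fin (n - 1)) : Equiv.Perm (Fin n) := Equiv.swap (lo i) (hi i)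

/-- The permutation `s_{i_1} ⋯ s_{i_ℓ}` given by a word `i_1, …, i_ℓ`. -/
def wordProd {n : ℕ} (a : List (Fin (n - 1))) : Equiv.Perm (Fin n) := (a.map s).prod

/-- `a` is a reduced word of `w`: a word for `w` of minimum length. -/
def IsReducedWord {n : ℕ} (a : List (Fin (n - 1))) (w : Equiv.Perm (Fin n)) : Prop :=
  wordProd a = w ∧ ∀ b : List (Fin (n - 1)), wordProd b = w → a.length ≤ b.length

theorem exists_wordProd {n : ℕ} (w : Equiv.Perm (Fin n)) :
    ∃ a : List (Fin (n - 1)), wordProd a = w := by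
  cases n with
  | zero => exact ⟨[], Subsingleton.elim _ _⟩
  | succ m =>
    have h : w ∈ Submonoid.closure
        (Set.range fun i : Fin m => Equiv.swap i.castSucc i.succ) := by
      rw [Equiv.Perm.mclosure_swap_castSucc_succ]; trivial
    induction h using Submonoid.closure_induction with
    | mem y hy =>
      obtain ⟨i, rfl⟩ := hy
      exact ⟨[i], by simp [wordProd, s, lo, hi, Fin.castSucc, Fin.succ]; rfl⟩
    | one => exact ⟨[], rfl⟩
    | mul y z _ _ hy hz =>
      obtain ⟨a, rfl⟩ := hy
      obtain ⟨b, rfl⟩ := hz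
      exact ⟨a ++ b, by simp [wordProd]⟩

theorem exists_isReducedWord {n : ℕ} (w : Equiv.Perm (Fin n)) :
    ∃ a : List (Fin (n - 1)), IsReducedWord a w := by
  obtain ⟨a, ha, hmin⟩ := WellFounded.has_min (measure (List.length (α := Fin (n - 1)))).wf
    {a | wordProd a = w} (exists_wordProd w)
  exact ⟨a, ha, fun b hb => not_lt.mp (hmin b hb)⟩

/-- A list of letters, each marked `true` (the factor is the transposition `s_i`) or `false`
(the factor is the generator `x_{i,i+1}`). This is the word of the letters marked `true`. -/
def chosen {n : ℕ} (c : List (Fin (n - 1) × Bool)) : List (Fin (n - 1)) :=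
  (c.filter fun p => p.2).map fun p => p.1

/-- Write `φ` for the product of the factors of a marked word, formed in the semidirect product
of `FK_n` with `S_n`, where `x_ij u = u x_{u⁻¹(i) u⁻¹(j)}`. Collecting the transpositions on the
left gives `φ = u P` with `u = wordProd (chosen c)` and `P` in `FK_n`; this is `P = u⁻¹ φ`. -/
noncomputable def collect {n : ℕ} : List (Fin (n - 1) × Bool) → FK n
  | [] => 1
  | (_, true) :: c => collect c
  | (i, false) :: c =>
      x ((wordProd (chosen c))⁻¹ (lo i)) ((wordProd (chosen c))⁻¹ (hi i)) * collect c

/-- The word `a` with its letters marked according to the set of positions with indicator `J`. -/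
def mark {n : ℕ} (a : List (Fin (n - 1))) (J : Fin a.length → Bool) :
    List (Fin (n - 1) × Bool) :=
  List.ofFn fun k => (a.get k, J k)

open Classical in
/-- `v⁻¹ ∑_J φ_J`, where `J` ranges over the subsets of the positions of the word `a`, given by
their indicators, for which the letters at the positions in `J` form a reduced word of `v`. Here
`φ_J` is the product over the positions `k` of `s_{a_k}` if `k ∈ J` and of `x_{a_k, a_k + 1}`
otherwise. -/
noncomputable def skewOfWord {n : ℕ} (a : List (Fin (n - 1))) (v : Equiv.Perm (Fin n)) : FK n :=
  ∑ J : Fin a.length → Bool,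
    if IsReducedWord (chosen (mark a J)) v then collect (mark a J) else 0

/-- The skew element `x_{w/v}`, computed from some reduced word of `w`. -/
noncomputable def xSkew {n : ℕ} (w v : Equiv.Perm (Fin n)) : FK n :=
  skewOfWord (exists_isReducedWord w).choose v

end FominKirillov

/-! Splitting the subsets J at the first letter gives `skewOfWord (i :: a) = stepOp i (skewOfWord
a)`. The operators `stepOp i` satisfy the commutation and braid relations (`stepOp_comm`,
`stepOp_braid`), so a Matsumoto-type induction shows that `skewOfWord a` depends only on the
permutation of which `a` is a reduced word.

This recursion is not visibly positive: at a left descent of v its factor x is negative. Solved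
backwards at a left ascent j of v, with p < q the preimages of j and j+1 under v, it becomes x_{w/v}
= x_pq x_{w/s_j v} + x_{s_j w/s_j v} if s_j w > w (`skewOfWord_eq_of_lt`), and x_{w/v} = x_pq
x_{w/s_j v} if s_j w < w (`skewOfWord_cons_of_lt`). Both preserve positivity and lengthen v. The
process ends at the longest v, where x_{w/v} is 0 or 1. -/

namespace FominKirillov

variable {n : ℕ}

/-! ### Relations in the Fomin–Kirillov algebra -/

theorem x_skew {i j : Fin n} (h : i ≠ j) : (x i j : FK n) = -x j i := by
  simpa [x] using RingQuot.mkAlgHom_rel ℂ (Rel.skew i j h)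

theorem x_sq {i j : Fin n} (h : i ≠ j) : (x i j : FK n) * x i j = 0 := by
  simpa [x] using RingQuot.mkAlgHom_rel ℂ (Rel.sq i j h)

theorem x_comm {i j k l : Fin n} (hij : i ≠ j) (hik : i ≠ k) (hil : i ≠ l)
    (hjk : j ≠ k) (hjl : j ≠ l) (hkl : k ≠ l) : (x i j : FK n) * x k l = x k l * x i j := by
  simpa [x] using RingQuot.mkAlgHom_rel ℂ (Rel.comm i j k l hij hik hil hjk hjl hkl)

theorem x_cyclic {i j k : Fin n} (hij : i ≠ j) (hjk : j ≠ k) (hik : i ≠ k) :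
    (x i j : FK n) * x j k + x j k * x k i + x k i * x i j = 0 := by
  simpa [x] using RingQuot.mkAlgHom_rel ℂ (Rel.cyclic i j k hij hjk hik)

/-- Multiply the cyclic relation by `x a b` on the right and by `x b c` on the left. Each time one
term dies by `x_sq`, and both results contain `x b c * x c a * x a b`. -/
theorem x_braid {a b c : Fin n} (hab : a ≠ b) (hbc : b ≠ c) (hac : a ≠ c) :
    (x a b : FK n) * x b c * x a b = x b c * x a b * x b c := by
  have h := x_cyclic hab hbc hac
  have h1 : (x a b : FK n) * x b c * x a b + x b c * x c a * x a b = 0 := by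
    have := congrArg (· * (x a b : FK n)) h
    simpa only [add_mul, mul_assoc, x_sq hab, mul_zero, add_zero, zero_mul] using this
  have h2 : (x b c : FK n) * x a b * x b c + x b c * x c a * x a b = 0 := by
    have := congrArg ((x b c : FK n) * ·) h
    simpa only [mul_add, ← mul_assoc, x_sq hbc, mul_zero, add_zero, zero_mul] using this
  exact add_right_cancel (h1.trans h2.symm)

/-- This form and the next one of the cyclic relation match the quadratic coefficients in
`stepOp_braid`. -/
theorem x_mul_add {a b c : Fin n} (hab : a ≠ b) (hbc : b ≠ c) (hac : a ≠ c) :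
    (x a b : FK n) * x b c + x a c * x b a = x b c * x a c := by
  have key {A : Type} [Ring A] {p q r : A} (h : p * q + q * -r + -r * p = 0) :
      p * q + r * -p = q * r := by
    rw [← sub_eq_zero, ← h]; noncomm_ring
  have h := x_cyclic hab hbc hac
  rw [x_skew hac.symm] at h
  rw [x_skew hab.symm]
  exact key h

theorem x_mul_add' {a b c : Fin n} (hab : a ≠ b) (hbc : b ≠ c) (hac : a ≠ c) :
    (x b c : FK n) * x a b + x a c * x c b = x a b * x a c := by
  have key {A : Type} [Ring A] {p q r : A} (h : r * -q + -q * -p + -p * r = 0) :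
      q * p + r * -q = p * r := by
    rw [← sub_eq_zero, ← h]; noncomm_ring
  have h := x_cyclic hac hbc.symm hab
  rw [x_skew hab.symm, x_skew hbc.symm] at h
  rw [x_skew hbc.symm]
  exact key h

/-! ### The positive cone -/

theorem one_mem_FKPos : (1 : FK n) ∈ FKPos n :=
  Submodule.subset_span ⟨[], by simp, by simp⟩

theorem x_mul_mem_FKPos {p q : Fin n} (hpq : p < q) {y : FK n} (hy : y ∈ FKPos n) :
    x p q * y ∈ FKPos n := by
  induction hy using Submodule.span_induction with
  | mem y hy =>
    obtain ⟨l, hl, rfl⟩ := hy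
    exact Submodule.subset_span ⟨(p, q) :: l, List.forall_mem_cons.2 ⟨hpq, hl⟩, by simp⟩
  | zero => simp
  | add y z _ _ hy hz => rw [mul_add]; exact add_mem hy hz
  | smul c y _ hy =>
    -- The scalar `c` acts through its image in ℂ, over which the algebra is defined.
    have h : x p q * c • y = c • (x p q * y) := mul_smul_comm ((c : ℝ) : ℂ) (x p q) y
    exact (congrArg (· ∈ FKPos n) h).mpr (Submodule.smul_mem _ c hy)

/-! ### Simple transpositions, inversions and reduced words -/

theorem lo_lt_hi (i : Fin (n - 1)) : lo i < hi i := by simp [lo, hi, Fin.lt_def]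

theorem s_lo (i : Fin (n - 1)) : s i (lo i) = hi i := Equiv.swap_apply_left _ _

theorem s_hi (i : Fin (n - 1)) : s i (hi i) = lo i := Equiv.swap_apply_right _ _

@[simp] theorem s_mul_self (i : Fin (n - 1)) : s i * s i = 1 := Equiv.swap_mul_self _ _

@[simp] theorem s_mul_s_mul (i : Fin (n - 1)) (v : Equiv.Perm (Fin n)) :
    s i * (s i * v) = v := by rw [← mul_assoc, s_mul_self, one_mul]

@[simp] theorem s_apply_s (i : Fin (n - 1)) (p : Fin n) : s i (s i p) = p :=
  Equiv.swap_apply_self _ _ _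

theorem inv_s_mul_apply (i : Fin (n - 1)) (v : Equiv.Perm (Fin n)) (p : Fin n) :
    (s i * v)⁻¹ p = v⁻¹ (s i p) := by
  rw [mul_inv_rev, Equiv.Perm.mul_apply, s, Equiv.swap_inv]

theorem inv_s_mul_lo (i : Fin (n - 1)) (v : Equiv.Perm (Fin n)) :
    (s i * v)⁻¹ (lo i) = v⁻¹ (hi i) := by rw [inv_s_mul_apply, s_lo]

theorem inv_s_mul_hi (i : Fin (n - 1)) (v : Equiv.Perm (Fin n)) :
    (s i * v)⁻¹ (hi i) = v⁻¹ (lo i) := by rw [inv_s_mul_apply, s_hi]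

theorem s_lt_s {i : Fin (n - 1)} {p q : Fin n} (hpq : p < q) (h : ¬(p = lo i ∧ q = hi i)) :
    s i p < s i q := by
  simp only [s, Equiv.swap_apply_def, lo, hi, Fin.ext_iff, Fin.lt_def] at *
  split_ifs <;> simp_all <;> omega

/-- The inversions of a permutation, recorded by their values. -/
def inversions (v : Equiv.Perm (Fin n)) : Finset (Fin n × Fin n) :=
  {p | p.1 < p.2 ∧ v⁻¹ p.2 < v⁻¹ p.1}

/-- The number of inversions of a permutation. -/
def invCount (v : Equiv.Perm (Fin n)) : ℕ := (inversions v).card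

theorem invCount_one : invCount (1 : Equiv.Perm (Fin n)) = 0 := by
  simp only [invCount, inversions, Finset.card_eq_zero, Finset.filter_eq_empty_iff]
  rintro p - ⟨h1, h2⟩
  exact lt_asymm h1 h2

/-- By `s_lt_s`, `s i` reverses no increasing pair except `(lo i, hi i)`. Hence it carries the
inversions of `v` to those of `s i * v`, and only that pair is new. -/
theorem invCount_s_mul_of_lt {i : Fin (n - 1)} {v : Equiv.Perm (Fin n)}
    (h : v⁻¹ (lo i) < v⁻¹ (hi i)) : invCount (s i * v) = invCount v + 1 := by
  have key : inversions (s i * v) =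
      insert (lo i, hi i) ((inversions v).map ((s i).prodCongr (s i)).toEmbedding) := by
    ext ⟨p, q⟩
    simp only [inversions, Finset.mem_filter, Finset.mem_univ, true_and, Finset.mem_insert,
      Finset.mem_map, Prod.exists, Prod.mk.injEq, Equiv.coe_toEmbedding, Equiv.prodCongr_apply,
      Prod.map_apply, inv_s_mul_apply]
    constructor
    · rintro ⟨hpq, hv⟩
      by_cases hl : p = lo i ∧ q = hi i
      · exact Or.inl hl
      · exact Or.inr ⟨s i p, s i q, ⟨s_lt_s hpq hl, hv⟩, by simp, by simp⟩
    · rintro (⟨rfl, rfl⟩ | ⟨p', q', ⟨hpq, hv⟩, rfl, rfl⟩)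
      · rw [s_lo, s_hi]; exact ⟨lo_lt_hi i, h⟩
      · simp only [s_apply_s]
        refine ⟨s_lt_s hpq ?_, hv⟩
        rintro ⟨rfl, rfl⟩
        exact lt_asymm h hv
  rw [invCount, key, Finset.card_insert_of_notMem, Finset.card_map, invCount]
  simp only [inversions, Finset.mem_filter, Finset.mem_univ, true_and,
      Finset.mem_map, Prod.exists, Prod.mk.injEq, Equiv.coe_toEmbedding, Equiv.prodCongr_apply,
      Prod.map_apply]
  rintro ⟨p, q, ⟨hpq, -⟩, hp, hq⟩
  have hp' : p = hi i := by rw [← s_lo, ← hp, s_apply_s]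
  have hq' : q = lo i := by rw [← s_hi, ← hq, s_apply_s]
  subst hp' hq'
  exact lt_asymm hpq (lo_lt_hi i)

theorem invCount_s_mul_of_gt {i : Fin (n - 1)} {v : Equiv.Perm (Fin n)}
    (h : v⁻¹ (hi i) < v⁻¹ (lo i)) : invCount (s i * v) + 1 = invCount v := by
  have := invCount_s_mul_of_lt (i := i) (v := s i * v) (by rwa [inv_s_mul_lo, inv_s_mul_hi])
  rw [s_mul_s_mul] at this
  exact this.symm

theorem inv_lo_ne_inv_hi (i : Fin (n - 1)) (v : Equiv.Perm (Fin n)) :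
    v⁻¹ (lo i) ≠ v⁻¹ (hi i) := fun h => (lo_lt_hi i).ne (v⁻¹.injective h)

theorem invCount_s_mul_le (i : Fin (n - 1)) (v : Equiv.Perm (Fin n)) :
    invCount (s i * v) ≤ invCount v + 1 := by
  rcases lt_or_gt_of_ne (inv_lo_ne_inv_hi i v) with h | h
  · exact (invCount_s_mul_of_lt h).le
  · have := invCount_s_mul_of_gt h
    omega

@[simp] theorem wordProd_nil : wordProd ([] : List (Fin (n - 1))) = 1 := rfl

@[simp] theorem wordProd_cons (i : Fin (n - 1)) (a : List (Fin (n - 1))) :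
    wordProd (i :: a) = s i * wordProd a := by simp [wordProd]

theorem invCount_wordProd_le (a : List (Fin (n - 1))) : invCount (wordProd a) ≤ a.length := by
  induction a with
  | nil => simp [invCount_one]
  | cons i a ih =>
    rw [wordProd_cons, List.length_cons]
    exact (invCount_s_mul_le _ _).trans (by omega)

theorem lt_of_forall_lo_lt_hi {α : Type*} [Preorder α] {f : Fin n → α}
    (h : ∀ i, f (lo i) < f (hi i)) : StrictMono f := by
  cases n with
  | zero => exact fun p => p.elim0
  | succ m => exact Fin.strictMono_iff_lt_succ.2 fun i => h i

/-- Strip left descents one at a time. Without descents `v⁻¹` is an order automorphism of a finite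
chain, hence the identity. -/
theorem exists_wordProd_length_eq (v : Equiv.Perm (Fin n)) :
    ∃ a : List (Fin (n - 1)), wordProd a = v ∧ a.length = invCount v := by
  induction hk : invCount v using Nat.strong_induction_on generalizing v with
  | _ k ih =>
    by_cases hd : ∃ i, v⁻¹ (hi i) < v⁻¹ (lo i)
    · obtain ⟨i, h⟩ := hd
      have h1 := invCount_s_mul_of_gt h
      obtain ⟨a, ha, hl⟩ := ih _ (by omega) (s i * v) rfl
      exact ⟨i :: a, by simp [ha], by simp only [List.length_cons]; omega⟩
    · push Not at hd
      have hm : StrictMono (v⁻¹ : Equiv.Perm (Fin n)) :=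
        lt_of_forall_lo_lt_hi fun i => (hd i).lt_of_ne (inv_lo_ne_inv_hi i v)
      have h1 : v⁻¹ = 1 := by
        have h2 : hm.orderIsoOfSurjective _ v⁻¹.surjective = OrderIso.refl _ :=
          Subsingleton.elim _ _
        ext p
        exact congrArg Fin.val (DFunLike.congr_fun h2 p)
      rw [inv_eq_one] at h1
      subst h1
      exact ⟨[], rfl, by rw [← hk, invCount_one]; rfl⟩

theorem isReducedWord_iff {a : List (Fin (n - 1))} {v : Equiv.Perm (Fin n)} :
    IsReducedWord a v ↔ wordProd a = v ∧ a.length = invCount v := by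
  constructor
  · rintro ⟨rfl, h⟩
    obtain ⟨b, hb, hl⟩ := exists_wordProd_length_eq (wordProd a)
    exact ⟨rfl, le_antisymm (hl ▸ h b hb) (invCount_wordProd_le a)⟩
  · rintro ⟨rfl, h⟩
    exact ⟨rfl, fun b hb => by rw [h, ← hb]; exact invCount_wordProd_le b⟩

theorem isReducedWord_cons {i : Fin (n - 1)} {a : List (Fin (n - 1))}
    {v : Equiv.Perm (Fin n)} :
    IsReducedWord (i :: a) v ↔ v⁻¹ (hi i) < v⁻¹ (lo i) ∧ IsReducedWord a (s i * v) := by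
  simp only [isReducedWord_iff, wordProd_cons, List.length_cons]
  constructor
  · rintro ⟨rfl, hl⟩
    have ha := invCount_wordProd_le a
    rcases lt_or_gt_of_ne (inv_lo_ne_inv_hi i (s i * wordProd a)) with h | h
    · have := invCount_s_mul_of_lt h
      rw [s_mul_s_mul] at this
      omega
    · have := invCount_s_mul_of_gt h
      exact ⟨h, by simp, by omega⟩
  · rintro ⟨h, ha, hl⟩
    have := invCount_s_mul_of_gt h
    exact ⟨by simp [ha], by omega⟩

/-! ### The recursion on the first letter -/

/-- The effect on skew elements of adding the letter `i` in front of a word. -/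
noncomputable def stepOp (i : Fin (n - 1)) (F : Equiv.Perm (Fin n) → FK n)
    (v : Equiv.Perm (Fin n)) : FK n :=
  x (v⁻¹ (lo i)) (v⁻¹ (hi i)) * F v + if v⁻¹ (hi i) < v⁻¹ (lo i) then F (s i * v) else 0

theorem skewOfWord_nil (v : Equiv.Perm (Fin n)) :
    skewOfWord [] v = if v = 1 then 1 else 0 := by
  have : IsReducedWord ([] : List (Fin (n - 1))) v ↔ v = 1 :=
    ⟨fun h => h.1.symm, fun h => ⟨h.symm, by simp⟩⟩
  simp only [skewOfWord, mark, List.length_nil, List.ofFn_zero, chosen, List.filter_nil,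
    List.map_nil, this, collect, Finset.univ_unique, Finset.sum_singleton]

theorem mark_cons (i : Fin (n - 1)) (a : List (Fin (n - 1))) (b : Bool)
    (J : Fin a.length → Bool) :
    mark (i :: a) (Fin.cons b J : Fin (a.length + 1) → Bool) = (i, b) :: mark a J := by
  simp [mark, List.ofFn_succ]

theorem skewOfWord_cons (i : Fin (n - 1)) (a : List (Fin (n - 1))) :
    skewOfWord (i :: a) = stepOp i (skewOfWord a) := by
  classical
  ext v
  have h0 : skewOfWord (i :: a) v = ∑ p : Bool × (Fin a.length → Bool),
      if IsReducedWord (chosen ((i, p.1) :: mark a p.2)) v then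
        collect ((i, p.1) :: mark a p.2) else 0 := by
    rw [skewOfWord]
    refine (Fintype.sum_equiv (Fin.consEquiv fun _ : Fin (a.length + 1) => Bool) _ _ ?_).symm
    rintro ⟨b, J⟩
    change _ = if IsReducedWord (chosen (mark (i :: a) (Fin.cons b J))) v then
      collect (mark (i :: a) (Fin.cons b J)) else 0
    rw [mark_cons]
  have ht (c : List (Fin (n - 1) × Bool)) : chosen ((i, true) :: c) = i :: chosen c := by
    simp [chosen]
  have hf (c : List (Fin (n - 1) × Bool)) : chosen ((i, false) :: c) = chosen c := by
    simp [chosen]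
  rw [h0, Fintype.sum_prod_type, Fintype.sum_bool, add_comm, stepOp]
  simp only [ht, hf, collect, isReducedWord_cons]
  congr 1
  · rw [skewOfWord, Finset.mul_sum]
    refine Finset.sum_congr rfl fun J _ => ?_
    split_ifs with h
    · rw [h.1]
    · simp
  · split_ifs with h
    · simp only [h, true_and, skewOfWord]
    · simp only [h, false_and, if_false, Finset.sum_const_zero]

/-! ### Independence of the reduced word -/

theorem s_apply_of_succ_lt {i j : Fin (n - 1)} (h : (i : ℕ) + 1 < j) :
    s j (lo i) = lo i ∧ s j (hi i) = hi i ∧ s i (lo j) = lo j ∧ s i (hi j) = hi j := by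
  refine ⟨?_, ?_, ?_, ?_⟩ <;> refine Equiv.swap_apply_of_ne_of_ne ?_ ?_ <;>
    simp only [lo, hi, ne_eq, Fin.ext_iff] <;> omega

theorem s_comm {i j : Fin (n - 1)} (h : (i : ℕ) + 1 < j) (v : Equiv.Perm (Fin n)) :
    s i * (s j * v) = s j * (s i * v) := by
  have h1 : lo i ≠ lo j := by simp [lo, Fin.ext_iff]; omega
  have h2 : lo i ≠ hi j := by simp [lo, hi, Fin.ext_iff]; omega
  have h3 : hi i ≠ lo j := by simp [lo, hi, Fin.ext_iff]; omega
  have h4 : hi i ≠ hi j := by simp [hi, Fin.ext_iff]; omega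
  rw [← mul_assoc, ← mul_assoc]
  congr 1
  exact (Equiv.Perm.disjoint_swap_swap (by simp [*, (lo_lt_hi i).ne, (lo_lt_hi j).ne])).commute

theorem lo_of_succ {i j : Fin (n - 1)} (h : (i : ℕ) + 1 = j) : lo j = hi i :=
  Fin.ext h.symm

theorem s_apply_of_succ {i j : Fin (n - 1)} (h : (i : ℕ) + 1 = j) :
    s i (hi j) = hi j ∧ s j (lo i) = lo i ∧ s j (hi i) = hi j ∧ s j (hi j) = hi i := by
  refine ⟨?_, ?_, lo_of_succ h ▸ s_lo j, lo_of_succ h ▸ s_hi j⟩ <;>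
    refine Equiv.swap_apply_of_ne_of_ne ?_ ?_ <;>
    simp only [lo, hi, ne_eq, Fin.ext_iff] <;> omega

theorem s_braid {i j : Fin (n - 1)} (h : (i : ℕ) + 1 = j) (v : Equiv.Perm (Fin n)) :
    s i * (s j * (s i * v)) = s j * (s i * (s j * v)) := by
  obtain ⟨e1, e2, e3, e4⟩ := s_apply_of_succ h
  simp only [← mul_assoc]
  congr 1
  ext p
  by_cases p1 : p = lo i
  · subst p1; simp [e1, e2, e3, s_lo]
  by_cases p2 : p = hi i
  · subst p2; simp [e1, e2, e3, e4, s_lo, s_hi]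
  by_cases p3 : p = hi j
  · subst p3; simp [e1, e2, e4, s_hi]
  have f1 : s i p = p := Equiv.swap_apply_of_ne_of_ne p1 p2
  have f2 : s j p = p := Equiv.swap_apply_of_ne_of_ne (lo_of_succ h ▸ p2) p3
  simp [f1, f2]

theorem stepOp_comm {i j : Fin (n - 1)} (h : (i : ℕ) + 1 < j)
    (F : Equiv.Perm (Fin n) → FK n) :
    stepOp i (stepOp j F) = stepOp j (stepOp i F) := by
  have h1 : lo i ≠ lo j := by simp [lo, Fin.ext_iff]; omega
  have h2 : lo i ≠ hi j := by simp [lo, hi, Fin.ext_iff]; omega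
  have h3 : hi i ≠ lo j := by simp [lo, hi, Fin.ext_iff]; omega
  have h4 : hi i ≠ hi j := by simp [hi, Fin.ext_iff]; omega
  ext v
  obtain ⟨e1, e2, e3, e4⟩ := s_apply_of_succ_lt h
  have inj := (v⁻¹).injective
  have hc : (x (v⁻¹ (lo i)) (v⁻¹ (hi i)) : FK n) * x (v⁻¹ (lo j)) (v⁻¹ (hi j)) =
      x (v⁻¹ (lo j)) (v⁻¹ (hi j)) * x (v⁻¹ (lo i)) (v⁻¹ (hi i)) :=
    x_comm (inj.ne (lo_lt_hi i).ne) (inj.ne h1) (inj.ne h2) (inj.ne h3) (inj.ne h4)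
      (inj.ne (lo_lt_hi j).ne)
  simp only [stepOp, inv_s_mul_apply, e1, e2, e3, e4, mul_add, ← mul_assoc, hc]
  simp only [mul_assoc, s_comm h]
  split_ifs <;> simp <;> abel

theorem stepOp_braid {i j : Fin (n - 1)} (h : (i : ℕ) + 1 = j)
    (F : Equiv.Perm (Fin n) → FK n) :
    stepOp i (stepOp j (stepOp i F)) = stepOp j (stepOp i (stepOp j F)) := by
  have hj : lo j = hi i := lo_of_succ h
  have h1 : lo i ≠ hi i := (lo_lt_hi i).ne
  have h2 : hi i ≠ hi j := by rw [← hj]; exact (lo_lt_hi j).ne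
  have h3 : lo i ≠ hi j := by simp [lo, hi, Fin.ext_iff]; omega
  obtain ⟨e1, e2, e3, e4⟩ := s_apply_of_succ h
  ext v
  have inj := (v⁻¹).injective
  simp only [stepOp, inv_s_mul_apply, hj, e1, e2, e3, e4, s_lo, s_hi, s_mul_s_mul, s_braid h]
  generalize hp : v⁻¹ (lo i) = a
  generalize hq : v⁻¹ (hi i) = b
  generalize hr : v⁻¹ (hi j) = c
  have hab : a ≠ b := by rw [← hp, ← hq]; exact inj.ne h1
  have hbc : b ≠ c := by rw [← hq, ← hr]; exact inj.ne h2
  have hac : a ≠ c := by rw [← hp, ← hr]; exact inj.ne h3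
  have r1 := x_braid hab hbc hac
  have r2 := x_mul_add hab hbc hac
  have r3 := x_mul_add' hab hbc hac
  -- Rewriting right to left brings the coefficients on both sides to common monomials; each
  -- ordering of `a`, `b`, `c` is then an additive identity.
  simp only [mul_add, ← mul_assoc, ← r1, ← r2, ← r3, mul_ite, mul_zero, add_mul]
  rcases lt_or_gt_of_ne hab with u1 | u1 <;> rcases lt_or_gt_of_ne hbc with u2 | u2 <;>
    rcases lt_or_gt_of_ne hac with u3 | u3 <;>
    simp only [u1, u2, u3, u1.not_gt, u2.not_gt, u3.not_gt, if_true, if_false, add_zero] <;>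
    abel

/-- The skew elements attached to two reduced words of the same permutation agree. -/
theorem skewOfWord_eq_of_isReducedWord {a b : List (Fin (n - 1))} {w : Equiv.Perm (Fin n)}
    (ha : IsReducedWord a w) (hb : IsReducedWord b w) : skewOfWord a = skewOfWord b := by
  induction hk : a.length using Nat.strong_induction_on generalizing a b w with
  | _ k ih =>
    have hlen : a.length = b.length := by
      rw [(isReducedWord_iff.1 ha).2, (isReducedWord_iff.1 hb).2]
    match a, b with
    | [], [] => rfl
    | [], _ :: _ => simp at hlen
    | _ :: _, [] => simp at hlen
    | i :: a, j :: b =>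
      simp only [List.length_cons] at hlen hk
      have ha' := isReducedWord_cons.1 ha
      have hb' := isReducedWord_cons.1 hb
      have main {i j : Fin (n - 1)} {a b : List (Fin (n - 1))} (hij : i < j)
          (ha : w⁻¹ (hi i) < w⁻¹ (lo i) ∧ IsReducedWord a (s i * w))
          (hb : w⁻¹ (hi j) < w⁻¹ (lo j) ∧ IsReducedWord b (s j * w))
          (hak : a.length + 1 = k) (hbk : b.length + 1 = k) :
          skewOfWord (i :: a) = skewOfWord (j :: b) := by
        rw [skewOfWord_cons, skewOfWord_cons]
        rcases (show (i : ℕ) + 1 ≤ j from hij).eq_or_lt with h | h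
        -- Both `i` and `j` are left descents of `w`, so `w` has reduced words `i :: j :: i :: c`
        -- and `j :: i :: j :: c` with a common tail.
        · obtain ⟨c, hc⟩ := exists_isReducedWord (s i * (s j * (s i * w)))
          have h1 : IsReducedWord (j :: i :: c) (s i * w) := by
            refine isReducedWord_cons.2 ⟨?_, isReducedWord_cons.2 ⟨?_, hc⟩⟩
            · simp only [inv_s_mul_apply, s_apply_of_succ h, lo_of_succ h, s_hi]
              exact (lo_of_succ h ▸ hb.1).trans ha.1
            · simp only [inv_s_mul_apply, s_apply_of_succ h, s_lo]
              exact lo_of_succ h ▸ hb.1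
          have h2 : IsReducedWord (i :: j :: c) (s j * w) := by
            refine isReducedWord_cons.2 ⟨?_, isReducedWord_cons.2 ⟨?_, ?_⟩⟩
            · simp only [inv_s_mul_apply, s_apply_of_succ h]
              exact (lo_of_succ h ▸ hb.1).trans ha.1
            · simp only [inv_s_mul_apply, s_apply_of_succ h, lo_of_succ h, s_hi]
              exact ha.1
            · rwa [← s_braid h]
          rw [ih _ (by omega) ha.2 h1 rfl, ih _ (by omega) hb.2 h2 rfl]
          simp only [skewOfWord_cons]
          exact stepOp_braid h _
        · obtain ⟨c, hc⟩ := exists_isReducedWord (s j * (s i * w))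
          have h1 : IsReducedWord (j :: c) (s i * w) := by
            refine isReducedWord_cons.2 ⟨?_, hc⟩
            simpa only [inv_s_mul_apply, s_apply_of_succ_lt h] using hb.1
          have h2 : IsReducedWord (i :: c) (s j * w) := by
            refine isReducedWord_cons.2 ⟨?_, by rwa [s_comm h]⟩
            simpa only [inv_s_mul_apply, s_apply_of_succ_lt h] using ha.1
          rw [ih _ (by omega) ha.2 h1 rfl, ih _ (by omega) hb.2 h2 rfl]
          simp only [skewOfWord_cons]
          exact stepOp_comm h _
      rcases lt_trichotomy i j with h | rfl | h
      · exact main h ha' hb' (by omega) (by omega)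
      · rw [skewOfWord_cons, skewOfWord_cons, ih _ (by omega) ha'.2 hb'.2 rfl]
      · exact (main h hb' ha' (by omega) (by omega)).symm

/-! ### Positivity -/

theorem skewOfWord_eq_zero_of_length_lt {a : List (Fin (n - 1))} {v : Equiv.Perm (Fin n)}
    (h : a.length < invCount v) : skewOfWord a v = 0 := by
  induction a generalizing v with
  | nil =>
    rw [skewOfWord_nil, if_neg]
    rintro rfl
    simp [invCount_one] at h
  | cons i a ih =>
    rw [List.length_cons] at h
    rw [skewOfWord_cons, stepOp, ih (by omega), mul_zero, zero_add]
    split_ifs with hd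
    · have := invCount_s_mul_of_gt hd
      exact ih (by omega)
    · rfl

/-- A reduced word of `v` can only be chosen by taking every letter, so no generator x survives. -/
theorem skewOfWord_mem_FKPos_of_length_le {a : List (Fin (n - 1))} {v : Equiv.Perm (Fin n)}
    (h : a.length ≤ invCount v) : skewOfWord a v ∈ FKPos n := by
  induction a generalizing v with
  | nil =>
    rw [skewOfWord_nil]
    split_ifs
    exacts [one_mem_FKPos, zero_mem _]
  | cons i a ih =>
    rw [List.length_cons] at h
    rw [skewOfWord_cons, stepOp, skewOfWord_eq_zero_of_length_lt (by omega), mul_zero, zero_add]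
    split_ifs with hd
    · have := invCount_s_mul_of_gt hd
      exact ih (by omega)
    · exact zero_mem _

theorem invCount_le_of_forall_gt {v : Equiv.Perm (Fin n)}
    (h : ∀ i, v⁻¹ (hi i) < v⁻¹ (lo i)) (w : Equiv.Perm (Fin n)) : invCount w ≤ invCount v := by
  have hm : StrictMono fun p => OrderDual.toDual (v⁻¹ p) := lt_of_forall_lo_lt_hi h
  refine Finset.card_le_card fun p hp => ?_
  simp only [inversions, Finset.mem_filter, Finset.mem_univ, true_and] at hp ⊢
  exact ⟨hp.1, hm hp.1⟩

/-- If `s j * v` is longer than `v`, then so is the word `j :: a` obtained from `a`, and the skew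
element of `a` at `v` is recovered from skew elements at `s j * v`. -/
theorem skewOfWord_eq_of_lt {j : Fin (n - 1)} {v : Equiv.Perm (Fin n)}
    (h : v⁻¹ (lo j) < v⁻¹ (hi j)) (a : List (Fin (n - 1))) :
    skewOfWord a v =
      x (v⁻¹ (lo j)) (v⁻¹ (hi j)) * skewOfWord a (s j * v) + skewOfWord (j :: a) (s j * v) := by
  have key {A : Type} [Ring A] (p q r : A) : r = p * q + (-p * q + r) := by noncomm_ring
  rw [skewOfWord_cons, stepOp, inv_s_mul_lo, inv_s_mul_hi, if_pos h, s_mul_s_mul,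
    x_skew (inv_lo_ne_inv_hi j v).symm]
  exact key _ _ _

/-- The value at `s j * v` is `-p * q + r`, where `p` is the factor x and `p * r` is the value at
`v`; multiplying by `p` kills the negative term since `p * p = 0`. -/
theorem skewOfWord_cons_of_lt {j : Fin (n - 1)} {v : Equiv.Perm (Fin n)}
    (h : v⁻¹ (lo j) < v⁻¹ (hi j)) (a : List (Fin (n - 1))) :
    skewOfWord (j :: a) v = x (v⁻¹ (lo j)) (v⁻¹ (hi j)) * skewOfWord (j :: a) (s j * v) := by
  have key {A : Type} [Ring A] {p : A} (hp : p * p = 0) (q r : A) :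
      p * r = p * (-p * q + r) := by
    rw [mul_add, ← mul_assoc, mul_neg, hp]; simp
  rw [skewOfWord_cons, stepOp, stepOp, inv_s_mul_lo, inv_s_mul_hi, if_pos h, s_mul_s_mul,
    if_neg h.not_gt, add_zero, x_skew (inv_lo_ne_inv_hi j v).symm]
  exact key (x_sq (inv_lo_ne_inv_hi j v)) _ _

theorem skewOfWord_mem_FKPos {a : List (Fin (n - 1))} {w : Equiv.Perm (Fin n)}
    (ha : IsReducedWord a w) (v : Equiv.Perm (Fin n)) : skewOfWord a v ∈ FKPos n := by
  have hbound (v : Equiv.Perm (Fin n)) : invCount v ≤ Fintype.card (Fin n × Fin n) :=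
    Finset.card_le_univ _
  -- Induction runs downwards on the length of `v`; `w` must vary because `s j * w` occurs.
  induction hk : Fintype.card (Fin n × Fin n) - invCount v using Nat.strong_induction_on
    generalizing v w a with
  | _ k ih =>
    by_cases hd : ∃ j, v⁻¹ (lo j) < v⁻¹ (hi j)
    · obtain ⟨j, hj⟩ := hd
      have hinv := invCount_s_mul_of_lt hj
      have hb := hbound (s j * v)
      have ih' {b : List (Fin (n - 1))} {u : Equiv.Perm (Fin n)} (hbu : IsReducedWord b u) :
          skewOfWord b (s j * v) ∈ FKPos n := ih _ (by omega) hbu _ rfl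
      rcases lt_or_gt_of_ne (inv_lo_ne_inv_hi j w) with hw | hw
      · rw [skewOfWord_eq_of_lt hj]
        refine add_mem (x_mul_mem_FKPos hj (ih' ha)) (ih' (u := s j * w) ?_)
        rw [isReducedWord_cons, s_mul_s_mul, inv_s_mul_lo, inv_s_mul_hi]
        exact ⟨hw, ha⟩
      · obtain ⟨b, hb⟩ := exists_isReducedWord (s j * w)
        have hjb : IsReducedWord (j :: b) w := isReducedWord_cons.2 ⟨hw, hb⟩
        -- Independence of the word allows one that starts with `j`.
        rw [skewOfWord_eq_of_isReducedWord ha hjb, skewOfWord_cons_of_lt hj]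
        exact x_mul_mem_FKPos hj (ih' hjb)
    · push Not at hd
      refine skewOfWord_mem_FKPos_of_length_le ?_
      rw [(isReducedWord_iff.1 ha).2]
      exact invCount_le_of_forall_gt
        (fun i => (hd i).lt_of_ne (inv_lo_ne_inv_hi i v).symm) w

end FominKirillov

theorem theorem3p5 (n : ℕ) (v w : Equiv.Perm (Fin n)) :
    (∀ a : List (Fin (n - 1)), FominKirillov.IsReducedWord a w →
      FominKirillov.skewOfWord a v = FominKirillov.xSkew w v) ∧
    FominKirillov.xSkew w v ∈ FominKirillov.FKPos n := by
  have h := (FominKirillov.exists_isReducedWord w).choose_spec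
  exact ⟨fun a ha => congrFun (FominKirillov.skewOfWord_eq_of_isReducedWord ha h) v,
    FominKirillov.skewOfWord_mem_FKPos h v⟩
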